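/- **Theorem (Existence).** Let $\{\mathcal X_i\}_{i\ge 0}$ and $\{\mathcal Y_i\}_{i\ge 0}$ be sequences of Polish spaces with their Borel $\sigma$-algebras, let $n\ge 0$, and put $\mathcal X_{0,n}=\prod_{i=0}^n\mathcal X_i$, $\mathcal Y_{0,n}=\prod_{i=0}^n\mathcal Y_i$, $x^i=(x_0,\dots,x_i)$, $y^i=(y_0,\dots,y_i)$. Assume that $\mathcal Y_{0,n}$ is compact. Let $P_{X^n}$ be a Borel probability measure on $\mathcal X_{0,n}$. Let $\overrightarrow{\mathcal Q}(\mathcal Y_{0,n};\mathcal X_{0,n})$ be the set of all stochastic kernels on $\mathcal Y_{0,n}$ given $\mathcal X_{0,n}$ of the causal form $$\overrightarrow P_{Y^n|X^n}(dy^n|x^n)=\bigotimes_{i=0}^n P_{Y_i|Y^{i-1},X^i}(dy_i|y^{i-1},x^i),$$ where each $P_{Y_i|Y^{i-1},X^i}$ is a stochastic kernel on $\mathcal Y_i$ given $\mathcal Y_{0,i-1}\times\mathcal X_{0,i}$ (for $i=0$, given $\mathcal X_0$). For such a kernel let $P_{Y^n}$ be the $\mathcal Y_{0,n}$-marginal of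 the joint law $P_{X^n}\otimes\overrightarrow P_{Y^n|X^n}$, and define the directed information as the Kullback--Leibler divergence $$\mathbb I_{X^n\to Y^n}(P_{X^n},\overrightarrow P_{Y^n|X^n})=\mathbb D\big(P_{X^n}\otimes\overrightarrow P_{Y^n|X^n}\,\big\|\,P_{X^n}\times P_{Y^n}\big)\in[0,\infty].$$ Let $d_{0,n}:\mathcal X_{0,n}\times\mathcal Y_{0,n}\to[0,\infty]$ be measurable and such that $d_{0,n}(x^n,\cdot)$ is continuous on $\mathcal Y_{0,n}$ for every $x^n\in\mathcal X_{0,n}$. Let $0\le D<\infty$ be such that the fidelity set $$\overrightarrow{\mathcal Q}_{0,n}(D)=\Big\{\overrightarrow P_{Y^n|X^n}\in\overrightarrow{\mathcal Q}(\mathcal Y_{0,n};\mathcal X_{0,n}):\int d_{0,n}\,d(P_{X^n}\otimes\overrightarrow P_{Y^n|X^n})\le D\Big\}$$ is non-empty. Then the infimum defining the nonanticipative rate distortion function $$R^{na}_{0,n}(D)=\inf_{\overrightarrow P_{Y^n|X^n}\in\overrightarrow{\mathcal Q}_{0,n}(D)}\mathbb I_{X^n\to Y^n}(P_{X^n},\overrightarrow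 P_{Y^n|X^n})$$ is attained: there is $\overrightarrow P^*_{Y^n|X^n}\in\overrightarrow{\mathcal Q}_{0,n}(D)$ with $\mathbb I_{X^n\to Y^n}(P_{X^n},\overrightarrow P^*_{Y^n|X^n})=R^{na}_{0,n}(D)$. -/

import Mathlib

open MeasureTheory ProbabilityTheory
open scoped ENNReal NNReal

universe u v

/-- `Hist Z k` is the space of strings `(z_0, …, z_{k-1})`, with `z_j ∈ Z_j`. In particular
`Hist X (n + 1)` is the space `X_{0,n} = X_0 × ⋯ × X_n`. -/
abbrev Hist (Z : ℕ → Type u) (k : ℕ) : Type u := ∀ j : Fin k, Z j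

/-- Forget the last letter of a string. -/
def Hist.init {Z : ℕ → Type u} {k : ℕ} (z : Hist Z (k + 1)) : Hist Z k :=
  fun j => z j.castSucc

/-- Append the letter `p.2` to the string `p.1`. -/
def Hist.snoc {Z : ℕ → Type u} {k : ℕ} (p : Hist Z k × Z k) : Hist Z (k + 1) :=
  Fin.snoc (α := fun j : Fin (k + 1) => Z j) p.1 p.2

theorem Hist.measurable_init {Z : ℕ → Type u} [∀ i, MeasurableSpace (Z i)] {k : ℕ} :
    Measurable (Hist.init : Hist Z (k + 1) → Hist Z k) :=
  measurable_pi_lambda _ fun j => measurable_pi_apply j.castSucc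

theorem Hist.measurable_snoc {Z : ℕ → Type u} [∀ i, MeasurableSpace (Z i)] {k : ℕ} :
    Measurable (Hist.snoc : Hist Z k × Z k → Hist Z (k + 1)) := by
  refine measurable_pi_lambda _ fun j => ?_
  refine Fin.lastCases ?_ (fun j => ?_) j
  · simpa [Hist.snoc] using measurable_snd
  · have h : Measurable fun p : Hist Z k × Z k => p.1 j :=
      (measurable_pi_apply j).comp measurable_fst
    simp only [Hist.snoc, Fin.snoc_castSucc]
    exact h

/-- A family of reproduction kernels: `κ i` is a kernel `κ_i(dy_i | y^{i-1}, x^i)`, where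
`y^{i-1} = (y_0, …, y_{i-1})` and `x^i = (x_0, …, x_i)`. -/
abbrev ReproductionKernels (X : ℕ → Type u) (Y : ℕ → Type v)
    [∀ i, MeasurableSpace (X i)] [∀ i, MeasurableSpace (Y i)] :=
  ∀ i : ℕ, Kernel (Hist Y i × Hist X (i + 1)) (Y i)

/-- The convolution `⊗_{i < k} κ_i(dy_i | y^{i-1}, x^i)` of the first `k` reproduction kernels, a
kernel from `(x_0, …, x_{k-1})` to `(y_0, …, y_{k-1})`. -/
noncomputable def causalProd {X : ℕ → Type u} {Y : ℕ → Type v}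
    [∀ i, MeasurableSpace (X i)] [∀ i, MeasurableSpace (Y i)]
    (κ : ReproductionKernels X Y) : ∀ k : ℕ, Kernel (Hist X k) (Hist Y k)
  | 0 => Kernel.const _ (Measure.dirac fun j => j.elim0)
  | k + 1 =>
      (((causalProd κ k).comap Hist.init Hist.measurable_init) ⊗ₖ
        ((κ k).comap Prod.swap measurable_swap)).map Hist.snoc

theorem isMarkovKernel_causalProd {X : ℕ → Type u} {Y : ℕ → Type v}
    [∀ i, MeasurableSpace (X i)] [∀ i, MeasurableSpace (Y i)]
    (κ : ReproductionKernels X Y) (k : ℕ) (hκ : ∀ i < k, IsMarkovKernel (κ i)) :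
    IsMarkovKernel (causalProd κ k) := by
  induction k with
  | zero => unfold causalProd; infer_instance
  | succ k ih =>
    have := ih fun i hi => hκ i (by omega)
    have := hκ k (by omega)
    unfold causalProd
    exact Kernel.IsMarkovKernel.map _ Hist.measurable_snoc

/-- The set of causal (nonanticipative) reproduction distributions on `Y_{0,n}` given `X_{0,n}`:
the kernels of the form `⊗_{i=0}^n κ_i(dy_i | y^{i-1}, x^i)` for some stochastic kernels `κ_i`. -/
def causalKernels (X : ℕ → Type u) (Y : ℕ → Type v)
    [∀ i, MeasurableSpace (X i)] [∀ i, MeasurableSpace (Y i)] (n : ℕ) :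
    Set (Kernel (Hist X (n + 1)) (Hist Y (n + 1))) :=
  {Q | ∃ κ : ReproductionKernels X Y,
    (∀ i ≤ n, IsMarkovKernel (κ i)) ∧ Q = causalProd κ (n + 1)}

/-- Directed information `I(X^n → Y^n)`, the Kullback-Leibler divergence of the joint law `P ⊗ Q`
of `(X^n, Y^n)` from the product of its marginals. -/
noncomputable def directedInfo {X : ℕ → Type u} {Y : ℕ → Type v}
    [∀ i, MeasurableSpace (X i)] [∀ i, MeasurableSpace (Y i)] {n : ℕ}
    (P : Measure (Hist X (n + 1))) (Q : Kernel (Hist X (n + 1)) (Hist Y (n + 1))) : ℝ≥0∞ :=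
  InformationTheory.klDiv (P ⊗ₘ Q) (P.prod (P ⊗ₘ Q).snd)

/-- The fidelity set: the causal reproduction distributions whose expected distortion is at most
`D`. -/
def fidelitySet {X : ℕ → Type u} {Y : ℕ → Type v}
    [∀ i, MeasurableSpace (X i)] [∀ i, MeasurableSpace (Y i)] {n : ℕ}
    (P : Measure (Hist X (n + 1))) (d : Hist X (n + 1) → Hist Y (n + 1) → ℝ≥0∞) (D : ℝ≥0) :
    Set (Kernel (Hist X (n + 1)) (Hist Y (n + 1))) :=
  {Q | Q ∈ causalKernels X Y n ∧ ∫⁻ z, d z.1 z.2 ∂(P ⊗ₘ Q) ≤ D}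

/-- The nonanticipative rate distortion function. -/
noncomputable def nonanticipativeRDF {X : ℕ → Type u} {Y : ℕ → Type v}
    [∀ i, MeasurableSpace (X i)] [∀ i, MeasurableSpace (Y i)] {n : ℕ}
    (P : Measure (Hist X (n + 1))) (d : Hist X (n + 1) → Hist Y (n + 1) → ℝ≥0∞) (D : ℝ≥0) :
    ℝ≥0∞ :=
  ⨅ Q ∈ fidelitySet P d D, directedInfo P Q

/-! The proof is the direct method, run on joint laws `π` instead of kernels. Feasible joint laws
form a weakly compact set and the objective is weakly lower semicontinuous, so a minimizer exists;
it is then disintegrated back into reproduction kernels.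

Lower semicontinuity (`lowerSemicontinuous_klDiv`) holds because the divergence is a supremum of the
functionals `dualKL g` over bounded continuous `g`. Compactness (`isCompact_causal_couplings`)
starts from Prokhorov: the first marginal is fixed and the second factor is compact. It remains to
see that the constraints are closed, although they involve functions that are merely measurable in
`x`. Since the first marginal is always `P`, such an integrand is an element of `L¹(P; C(B, ℝ))`,
where continuous functions are dense; this is `continuousOn_integral_couplingsWithFst`.

Causality is expressed as conditional independence: given `x^k`, the letters `y^k` are independent
of the whole string `x`. By `factorsThrough_iff` this is a family of equations linear in `π`, hence
closed. `isCausal_compProd_causalProd` and `eq_compProd_causalProd_of_isCausal` show that it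
characterizes the joint laws of causal kernels. -/

/-! ### Lower semicontinuity of the Kullback-Leibler divergence by duality -/

section KLLowerSemicontinuous

open InformationTheory Filter Topology BoundedContinuousFunction

/-- Fenchel-Young inequality for `klFun`. -/
theorem mul_le_klFun_add_exp_sub_one {a : ℝ} (ha : 0 ≤ a) (g : ℝ) :
    a * g ≤ klFun a + (Real.exp g - 1) := by
  rcases ha.eq_or_lt with rfl | ha
  · simp [klFun, (Real.exp_pos g).le]
  -- Multiplied by `a`, this tangent-line inequality is exactly the claim.
  · have h := Real.add_one_le_exp (g - Real.log a)
    rw [Real.exp_sub, Real.exp_log ha, le_div_iff₀ ha] at h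
    unfold klFun
    linarith

/-- The Donsker-Varadhan type functional `∫ g dμ - ∫ (e^g - 1) dν`. -/
noncomputable def dualKL {Ω : Type*} [MeasurableSpace Ω] (g : Ω → ℝ) (μ ν : Measure Ω) : ℝ :=
  ∫ ω, g ω ∂μ - ∫ ω, (Real.exp (g ω) - 1) ∂ν

variable {Ω : Type*} [MeasurableSpace Ω]

theorem integrable_of_measurable_of_bound {g : Ω → ℝ} (hg : Measurable g) {M : ℝ}
    (hM : ∀ ω, |g ω| ≤ M) (μ : Measure Ω) [IsFiniteMeasure μ] : Integrable g μ :=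
  Integrable.of_bound hg.aestronglyMeasurable M (ae_of_all _ hM)

theorem integrable_exp_sub_one_of_bound {g : Ω → ℝ} (hg : Measurable g) {M : ℝ}
    (hM : ∀ ω, |g ω| ≤ M) (ν : Measure Ω) [IsFiniteMeasure ν] :
    Integrable (fun ω => Real.exp (g ω) - 1) ν := by
  refine (Integrable.of_bound (C := Real.exp M) hg.exp.aestronglyMeasurable
    (ae_of_all _ fun ω => ?_)).sub (integrable_const 1)
  rw [Real.norm_eq_abs, Real.abs_exp]
  exact Real.exp_le_exp.2 ((le_abs_self _).trans (hM ω))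

theorem integral_eq_integral_rnDeriv_mul {μ ν : Measure Ω} [IsFiniteMeasure μ] [IsFiniteMeasure ν]
    (h : μ ≪ ν) (g : Ω → ℝ) : ∫ ω, g ω ∂μ = ∫ ω, (μ.rnDeriv ν ω).toReal * g ω ∂ν := by
  simpa [smul_eq_mul] using (integral_rnDeriv_smul (f := g) h).symm

theorem integrable_rnDeriv_mul {μ ν : Measure Ω} [IsFiniteMeasure μ] [IsFiniteMeasure ν]
    (h : μ ≪ ν) {g : Ω → ℝ} (hg : Integrable g μ) :
    Integrable (fun ω => (μ.rnDeriv ν ω).toReal * g ω) ν := by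
  simpa [smul_eq_mul] using (integrable_rnDeriv_smul_iff h).2 hg

/-- Fenchel-Young with `a = dμ/dν`, integrated against `ν`. -/
theorem ofReal_dualKL_le_klDiv {g : Ω → ℝ} (hg : Measurable g) {M : ℝ} (hM : ∀ ω, |g ω| ≤ M)
    (μ ν : Measure Ω) [IsFiniteMeasure μ] [IsFiniteMeasure ν] :
    ENNReal.ofReal (dualKL g μ ν) ≤ klDiv μ ν := by
  by_cases htop : klDiv μ ν = ∞
  · simp [htop]
  obtain ⟨hac, hint⟩ := klDiv_ne_top_iff.1 htop
  rw [← ENNReal.ofReal_toReal htop]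
  refine ENNReal.ofReal_le_ofReal ?_
  rw [toReal_klDiv_eq_integral_klFun hac, dualKL, integral_eq_integral_rnDeriv_mul hac,
    sub_le_iff_le_add, ← integral_add ((integrable_klFun_rnDeriv_iff hac).2 hint)
      (integrable_exp_sub_one_of_bound hg hM ν)]
  refine integral_mono (integrable_rnDeriv_mul hac (integrable_of_measurable_of_bound hg hM μ))
    (((integrable_klFun_rnDeriv_iff hac).2 hint).add (integrable_exp_sub_one_of_bound hg hM ν))
    fun ω => mul_le_klFun_add_exp_sub_one ENNReal.toReal_nonneg _

/-- Truncation of a nonnegative number to `[1/(k+1), k+1]`. -/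
noncomputable def truncPos (k : ℕ) (a : ℝ) : ℝ := max ((k + 1 : ℝ)⁻¹) (min a (k + 1))

theorem truncPos_bounds (k : ℕ) (a : ℝ) :
    (k + 1 : ℝ)⁻¹ ≤ truncPos k a ∧ truncPos k a ≤ k + 1 := by
  refine ⟨le_max_left _ _, max_le ?_ (min_le_right _ _)⟩
  have : (1 : ℝ) ≤ k + 1 := by linarith [k.cast_nonneg (α := ℝ)]
  exact (inv_le_one_of_one_le₀ this).trans this

theorem abs_log_truncPos_le (k : ℕ) (a : ℝ) : |Real.log (truncPos k a)| ≤ Real.log (k + 1) := by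
  have hk : (0 : ℝ) < k + 1 := by positivity
  obtain ⟨h1, h2⟩ := truncPos_bounds k a
  have h0 : 0 < truncPos k a := (inv_pos.2 hk).trans_le h1
  rw [abs_le]
  refine ⟨?_, Real.log_le_log h0 h2⟩
  rw [← Real.log_inv]
  exact Real.log_le_log (inv_pos.2 hk) h1

/-- With `t = truncPos k a`, the two sides differ by `(a - t) * log t`. This is nonnegative because
truncation lowers `a` only to a value `≥ 1` and raises it only to a value `≤ 1`. The right side is
the `dualKL` integrand for `g = log t`, written over `ν`. -/
theorem klFun_truncPos_le (k : ℕ) (a : ℝ) :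
    klFun (truncPos k a) ≤ a * Real.log (truncPos k a) - (truncPos k a - 1) := by
  have hk : (1 : ℝ) ≤ k + 1 := by linarith [k.cast_nonneg (α := ℝ)]
  have h0 : 0 < truncPos k a := (inv_pos.2 (by linarith)).trans_le (truncPos_bounds k a).1
  have key : 0 ≤ (a - truncPos k a) * Real.log (truncPos k a) := by
    rcases le_total a (truncPos k a) with h | h
    · have h1 : truncPos k a ≤ 1 ∨ a = truncPos k a := by
        unfold truncPos at h ⊢
        rcases le_total a (k + 1) with h' | h'
        · rw [min_eq_left h'] at h ⊢
          rcases le_total ((k + 1 : ℝ)⁻¹) a with h'' | h''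
          · right; rw [max_eq_right h'']
          · left; rw [max_eq_left h'']; exact inv_le_one_of_one_le₀ hk
        · rw [min_eq_right h'] at h ⊢
          right
          refine le_antisymm h (max_le ?_ h')
          exact (inv_le_one_of_one_le₀ hk).trans (hk.trans h')
      rcases h1 with h1 | h1
      · exact mul_nonneg_of_nonpos_of_nonpos (by linarith) (Real.log_nonpos h0.le h1)
      · rw [← h1]; simp
    · have h1 : 1 ≤ truncPos k a ∨ a = truncPos k a := by
        rcases le_total a (k + 1) with h' | h'
        · right
          refine le_antisymm ?_ h
          unfold truncPos
          rw [min_eq_left h']; exact le_max_right _ _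
        · left
          unfold truncPos
          rw [min_eq_right h']; exact hk.trans (le_max_right _ _)
      rcases h1 with h1 | h1
      · exact mul_nonneg (by linarith) (Real.log_nonneg h1)
      · rw [← h1]; simp
  unfold klFun
  nlinarith

theorem tendsto_truncPos {a : ℝ} (ha : 0 ≤ a) :
    Tendsto (fun k : ℕ => truncPos k a) atTop (𝓝 a) := by
  have h1 : Tendsto (fun k : ℕ => (k + 1 : ℝ)⁻¹) atTop (𝓝 0) := by
    simpa using tendsto_one_div_add_atTop_nhds_zero_nat (𝕜 := ℝ)
  have h2 : Tendsto (fun k : ℕ => min a (k + 1 : ℝ)) atTop (𝓝 a) := by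
    obtain ⟨N, hN⟩ := exists_nat_ge a
    refine tendsto_const_nhds.congr' ?_
    filter_upwards [eventually_ge_atTop N] with k hk
    have : (N : ℝ) ≤ k := by exact_mod_cast hk
    rw [min_eq_left (by linarith)]
  have h3 := h1.max h2
  rw [max_eq_right ha] at h3
  exact h3

theorem measurable_truncPos (k : ℕ) : Measurable (truncPos k) :=
  measurable_const.max (measurable_id.min measurable_const)

/-- The optimal test function `log (dμ/dν)` may be unbounded, so its truncations are used, and
Fatou's lemma shows that they lose nothing in the limit. Without absolute continuity, a large
multiple of the indicator of a `ν`-null set charged by `μ` does the job. -/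
theorem exists_measurable_lt_dualKL {μ ν : Measure Ω} [IsFiniteMeasure μ] [IsFiniteMeasure ν]
    {c : ℝ≥0∞} (hc : c < klDiv μ ν) :
    ∃ g : Ω → ℝ, Measurable g ∧ (∃ M, ∀ ω, |g ω| ≤ M) ∧ c < ENNReal.ofReal (dualKL g μ ν) := by
  have hctop : c ≠ ∞ := hc.ne_top
  by_cases hac : μ ≪ ν
  · rw [klDiv_eq_lintegral_klFun_of_ac hac] at hc
    set f : Ω → ℝ := fun ω => (μ.rnDeriv ν ω).toReal with hf
    have hfm : Measurable f := (Measure.measurable_rnDeriv μ ν).ennreal_toReal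
    have hF : ∫⁻ ω, ENNReal.ofReal (klFun (f ω)) ∂ν
        ≤ liminf (fun k : ℕ => ∫⁻ ω, ENNReal.ofReal (klFun (truncPos k (f ω))) ∂ν) atTop := by
      refine le_trans (lintegral_mono fun ω => ?_) (lintegral_liminf_le fun k => ?_)
      · refine le_of_eq (Tendsto.liminf_eq ?_).symm
        exact ENNReal.tendsto_ofReal ((continuous_klFun.tendsto _).comp
          (tendsto_truncPos ENNReal.toReal_nonneg))
      · exact (measurable_klFun.comp ((measurable_truncPos k).comp hfm)).ennreal_ofReal
    obtain ⟨k, hk⟩ := (eventually_lt_of_lt_liminf (hc.trans_le hF)).exists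
    have hgm : Measurable fun ω => Real.log (truncPos k (f ω)) :=
      ((measurable_truncPos k).comp hfm).log
    have hgM : ∀ ω, |Real.log (truncPos k (f ω))| ≤ Real.log (k + 1) :=
      fun ω => abs_log_truncPos_le k _
    have hpos : ∀ ω, 0 < truncPos k (f ω) := fun ω =>
      (inv_pos.2 (by positivity : (0 : ℝ) < k + 1)).trans_le (truncPos_bounds k _).1
    refine ⟨_, hgm, ⟨_, hgM⟩, hk.trans_le ?_⟩
    have hi1 := integrable_rnDeriv_mul hac (integrable_of_measurable_of_bound hgm hgM μ)
    have hi2 := integrable_exp_sub_one_of_bound hgm hgM ν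
    rw [dualKL, integral_eq_integral_rnDeriv_mul hac, ← integral_sub hi1 hi2]
    refine le_trans ?_ (ofReal_integral_eq_lintegral_ofReal (hi1.sub hi2) ?_).ge
    · refine lintegral_mono fun ω => ENNReal.ofReal_le_ofReal ?_
      rw [Pi.sub_apply, Real.exp_log (hpos ω)]
      exact klFun_truncPos_le k _
    · refine ae_of_all _ fun ω => ?_
      simp only [Pi.zero_apply]
      rw [Pi.sub_apply, Real.exp_log (hpos ω)]
      exact (klFun_nonneg (hpos ω).le).trans (klFun_truncPos_le k _)
  · obtain ⟨A, hA, hνA, hμA⟩ : ∃ A, MeasurableSet A ∧ ν A = 0 ∧ μ A ≠ 0 := by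
      by_contra! h
      exact hac (Measure.AbsolutelyContinuous.mk fun s hs h0 => h s hs h0)
    have hμA' : 0 < μ.real A := ENNReal.toReal_pos hμA (measure_ne_top _ _)
    -- The `ν`-term vanishes for this test function, so its dual value is `K * μ.real A`.
    obtain ⟨K, hK⟩ := exists_nat_gt (c.toReal / μ.real A)
    have hgm : Measurable (A.indicator fun _ => (K : ℝ)) := measurable_const.indicator hA
    refine ⟨A.indicator fun _ => (K : ℝ), hgm, ⟨K, fun ω => ?_⟩, ?_⟩
    · by_cases h : ω ∈ A <;> simp [h]
    · have h0 : ∫ ω, (Real.exp (A.indicator (fun _ => (K : ℝ)) ω) - 1) ∂ν = 0 := by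
        refine integral_eq_zero_of_ae ?_
        have : ∀ᵐ ω ∂ν, ω ∉ A := measure_eq_zero_iff_ae_notMem.1 hνA
        filter_upwards [this] with ω hω
        simp [hω]
      rw [dualKL, h0, sub_zero, integral_indicator_const _ hA, smul_eq_mul,
        ENNReal.lt_ofReal_iff_toReal_lt hctop]
      rwa [div_lt_iff₀ hμA', mul_comm] at hK

theorem abs_exp_sub_exp_le {a b M : ℝ} (ha : |a| ≤ M) (hb : |b| ≤ M) :
    |Real.exp a - Real.exp b| ≤ Real.exp M * |a - b| := by
  wlog h : b ≤ a generalizing a b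
  · rw [abs_sub_comm, abs_sub_comm a b]
    exact this hb ha (le_of_not_ge h)
  rw [abs_of_nonneg (sub_nonneg.2 (Real.exp_le_exp.2 h)), abs_of_nonneg (sub_nonneg.2 h)]
  have h1 := Real.add_one_le_exp (b - a)
  have h2 : Real.exp b = Real.exp a * Real.exp (b - a) := by rw [← Real.exp_add]; congr 1; ring
  have h3 : Real.exp a ≤ Real.exp M := Real.exp_le_exp.2 ((le_abs_self a).trans ha)
  have h4 := Real.exp_pos a
  nlinarith [mul_le_mul_of_nonneg_right h3 (sub_nonneg.2 h)]

theorem abs_clamp_sub_le {a b M : ℝ} (ha : |a| ≤ M) :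
    |a - max (-M) (min b M)| ≤ |a - b| := by
  obtain ⟨h1, h2⟩ := abs_le.1 ha
  have : a = max (-M) (min a M) := by rw [min_eq_left h2, max_eq_right h1]
  calc |a - max (-M) (min b M)| = |max (-M) (min a M) - max (-M) (min b M)| := by rw [← this]
    _ ≤ |min a M - min b M| := by
        simpa using abs_max_sub_max_le_max (-M) (min a M) (-M) (min b M)
    _ ≤ |a - b| := by simpa using abs_min_sub_min_le_max a M b M

theorem continuous_dualKL [TopologicalSpace Ω] [OpensMeasurableSpace Ω] (g : Ω →ᵇ ℝ) :
    Continuous fun p : ProbabilityMeasure Ω × ProbabilityMeasure Ω =>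
      dualKL g (p.1 : Measure Ω) (p.2 : Measure Ω) := by
  have hexp : ∃ e : Ω →ᵇ ℝ, ∀ ω, e ω = Real.exp (g ω) - 1 := by
    refine ⟨BoundedContinuousFunction.ofNormedAddCommGroup (fun ω => Real.exp (g ω) - 1)
      (by fun_prop) (Real.exp ‖g‖ + 1) fun ω => ?_, fun ω => rfl⟩
    refine (norm_sub_le _ _).trans ?_
    simp only [Real.norm_eq_abs, Real.abs_exp, abs_one]
    gcongr
    exact (le_abs_self _).trans (g.norm_coe_le_norm ω)
  obtain ⟨e, he⟩ := hexp
  have h (f : Ω →ᵇ ℝ) : Continuous fun p : ProbabilityMeasure Ω => ∫ ω, f ω ∂(p : Measure Ω) :=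
    continuous_iff_continuousAt.2 fun p =>
      (ProbabilityMeasure.tendsto_iff_forall_integral_tendsto.1 tendsto_id) f
  simp_rw [dualKL, ← he]
  exact ((h g).comp continuous_fst).sub ((h e).comp continuous_snd)

variable [TopologicalSpace Ω] [BorelSpace Ω] [TopologicalSpace.PseudoMetrizableSpace Ω]

/-- Bounded continuous functions are dense in `L¹(μ + ν)`, which controls the errors under `μ` and
`ν` at once. Clamping to `[-M, M]` does not worsen the approximation and makes `exp` Lipschitz with
constant `exp M` on the relevant range. -/
theorem exists_continuous_lt_dualKL {μ ν : Measure Ω} [IsFiniteMeasure μ] [IsFiniteMeasure ν]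
    {c : ℝ≥0∞} (hc : c < klDiv μ ν) :
    ∃ g : Ω →ᵇ ℝ, c < ENNReal.ofReal (dualKL g μ ν) := by
  obtain ⟨g, hgm, ⟨M, hM⟩, hcg⟩ := exists_measurable_lt_dualKL hc
  rw [ENNReal.lt_ofReal_iff_toReal_lt hc.ne_top] at hcg
  set δ := dualKL g μ ν - c.toReal with hδ
  have hδ0 : 0 < δ := sub_pos.2 hcg
  -- The total loss will be at most `(1 + exp M) * ε = δ / 2`, half of the available gap.
  set ε := δ / (2 * (1 + Real.exp M)) with hε
  have hE := Real.exp_pos M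
  have hε0 : 0 < ε := by positivity
  obtain ⟨h, hh, -⟩ := (integrable_of_measurable_of_bound hgm hM
    (μ + ν)).exists_boundedContinuous_integral_sub_le hε0
  have hc' : Continuous fun ω => max (-M) (min (h ω) M) :=
    continuous_const.max (h.continuous.min continuous_const)
  have hb : ∀ (_ : Ω) (t : ℝ), |max (-M) (min t M)| ≤ M := fun ω t => by
    have : 0 ≤ M := (abs_nonneg _).trans (hM ω)
    rw [abs_le]
    exact ⟨le_max_left _ _, max_le (by linarith) (min_le_right _ _)⟩
  set h' : Ω →ᵇ ℝ := BoundedContinuousFunction.ofNormedAddCommGroup _ hc' M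
    (fun ω => hb ω (h ω)) with hh'
  have hM' : ∀ ω, |h' ω| ≤ M := fun ω => hb ω (h ω)
  have hm' : Measurable h' := hc'.measurable
  have hle : ∀ ω, |g ω - h' ω| ≤ |g ω - h ω| := fun ω => abs_clamp_sub_le (hM ω)
  have hsum : ∫ ω, |g ω - h' ω| ∂μ + ∫ ω, |g ω - h' ω| ∂ν ≤ ε := by
    rw [← integral_add_measure]
    · refine (integral_mono ?_ ?_ hle).trans hh
      · exact ((integrable_of_measurable_of_bound hgm hM _).sub
          (integrable_of_measurable_of_bound hm' hM' _)).abs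
      · exact ((integrable_of_measurable_of_bound hgm hM _).sub (h.integrable _)).abs
    · exact ((integrable_of_measurable_of_bound hgm hM _).sub
          (integrable_of_measurable_of_bound hm' hM' _)).abs
    · exact ((integrable_of_measurable_of_bound hgm hM _).sub
          (integrable_of_measurable_of_bound hm' hM' _)).abs
  have h1 : |∫ ω, g ω ∂μ - ∫ ω, h' ω ∂μ| ≤ ∫ ω, |g ω - h' ω| ∂μ := by
    rw [← integral_sub (integrable_of_measurable_of_bound hgm hM _)
      (integrable_of_measurable_of_bound hm' hM' _)]
    exact abs_integral_le_integral_abs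
  have h2 : |∫ ω, (Real.exp (g ω) - 1) ∂ν - ∫ ω, (Real.exp (h' ω) - 1) ∂ν|
      ≤ Real.exp M * ∫ ω, |g ω - h' ω| ∂ν := by
    rw [← integral_sub (integrable_exp_sub_one_of_bound hgm hM _)
      (integrable_exp_sub_one_of_bound hm' hM' _), ← integral_const_mul]
    refine abs_integral_le_integral_abs.trans (integral_mono ?_ ?_ fun ω => ?_)
    · exact ((integrable_exp_sub_one_of_bound hgm hM _).sub
        (integrable_exp_sub_one_of_bound hm' hM' _)).abs
    · exact (((integrable_of_measurable_of_bound hgm hM _).sub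
        (integrable_of_measurable_of_bound hm' hM' _)).abs).const_mul _
    · simpa using abs_exp_sub_exp_le (hM ω) (hM' ω)
  refine ⟨h', ?_⟩
  rw [ENNReal.lt_ofReal_iff_toReal_lt hc.ne_top]
  have h3 : 0 ≤ ∫ ω, |g ω - h' ω| ∂μ := integral_nonneg fun _ => abs_nonneg _
  have h4 : 0 ≤ ∫ ω, |g ω - h' ω| ∂ν := integral_nonneg fun _ => abs_nonneg _
  have h5 : (1 + Real.exp M) * ε = δ / 2 := by rw [hε]; field_simp
  have h6 : dualKL g μ ν - dualKL h' μ ν ≤ (1 + Real.exp M) * ε := by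
    unfold dualKL
    have := (abs_le.1 h1).2
    have := (abs_le.1 h2).1
    nlinarith [mul_nonneg hE.le h3]
  linarith

/-- The Kullback-Leibler divergence is jointly lower semicontinuous for weak convergence. -/
theorem lowerSemicontinuous_klDiv :
    LowerSemicontinuous fun p : ProbabilityMeasure Ω × ProbabilityMeasure Ω =>
      klDiv (p.1 : Measure Ω) (p.2 : Measure Ω) := by
  intro p c hc
  obtain ⟨g, hg⟩ := exists_continuous_lt_dualKL hc
  have hcont := ENNReal.continuous_ofReal.comp (continuous_dualKL g)
  filter_upwards [hcont.continuousAt.eventually (lt_mem_nhds hg)] with q hq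
  exact hq.trans_le (ofReal_dualKL_le_klDiv g.continuous.measurable (fun ω => g.norm_coe_le_norm ω)
    _ _)

end KLLowerSemicontinuous

/-! ### Couplings with fixed first marginal: compactness and integrands measurable in `x` -/

section Couplings

open Filter Topology BoundedContinuousFunction

variable {A B : Type*} [MeasurableSpace A]

/-- The probability measures on `A × B` with first marginal `P`. -/
def couplingsWithFst (B : Type*) [MeasurableSpace B] (P : Measure A) :
    Set (ProbabilityMeasure (A × B)) :=
  {π | (π : Measure (A × B)).fst = P}

variable [TopologicalSpace B] [PolishSpace B]

section

variable [CompactSpace B]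

/-- Evaluation along a dense sequence is a continuous injection of the Polish space `C(B, ℝ)` into
`ℕ → ℝ`, hence a measurable embedding by Lusin-Souslin. -/
theorem stronglyMeasurable_continuousMap {F : A → C(B, ℝ)}
    (hF : ∀ y, Measurable fun x => F x y) : StronglyMeasurable F := by
  borelize C(B, ℝ)
  refine Measurable.stronglyMeasurable ?_
  rcases isEmpty_or_nonempty B with hB | hB
  · have : Subsingleton C(B, ℝ) := ⟨fun f g => by ext y; exact hB.elim y⟩
    exact measurable_of_subsingleton_codomain _
  have hc : Continuous fun (f : C(B, ℝ)) (k : ℕ) => f (TopologicalSpace.denseSeq B k) :=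
    continuous_pi fun k => continuous_eval_const _
  have hi : Function.Injective fun (f : C(B, ℝ)) (k : ℕ) => f (TopologicalSpace.denseSeq B k) := by
    intro f g h
    refine ContinuousMap.coe_injective
      (f.continuous.ext_on (TopologicalSpace.denseRange_denseSeq B) g.continuous ?_)
    rintro _ ⟨k, rfl⟩
    exact congrFun h k
  exact (hc.measurableEmbedding hi).measurable_comp_iff.1 (measurable_pi_lambda _ fun k => hF _)

variable [MeasurableSpace B] [BorelSpace B]

theorem aestronglyMeasurable_uncurry_of_fst {P : Measure A} {F : A → C(B, ℝ)}
    (hF : AEStronglyMeasurable F P) {π : Measure (A × B)} (hπ : π.fst = P) :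
    AEStronglyMeasurable (fun z => F z.1 z.2) π := by
  have h1 : AEStronglyMeasurable (fun z : A × B => F z.1) π := by
    refine AEStronglyMeasurable.comp_measurable (f := Prod.fst) ?_ measurable_fst
    rw [← Measure.fst, hπ]; exact hF
  have h2 : AEStronglyMeasurable (fun z : A × B => z.2) π :=
    measurable_snd.stronglyMeasurable.aestronglyMeasurable
  exact (continuous_eval (F := C(B, ℝ))).comp_aestronglyMeasurable (h1.prodMk h2)

theorem integrable_uncurry_of_fst {P : Measure A} {F : A → C(B, ℝ)}
    (hF : Integrable F P) {π : Measure (A × B)} (hπ : π.fst = P) :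
    Integrable (fun z => F z.1 z.2) π := by
  have h : Integrable (fun z : A × B => ‖F z.1‖) π := by
    refine Integrable.comp_measurable (f := Prod.fst) (g := fun x => ‖F x‖) ?_ measurable_fst
    rw [← Measure.fst, hπ]; exact hF.norm
  exact h.mono' (aestronglyMeasurable_uncurry_of_fst hF.1 hπ)
    (ae_of_all _ fun z => (F z.1).norm_coe_le_norm z.2)

end

variable [MeasurableSpace B] [BorelSpace B] [TopologicalSpace A] [PolishSpace A] [BorelSpace A]

theorem isClosed_couplingsWithFst (P : Measure A) [IsProbabilityMeasure P] :
    IsClosed (couplingsWithFst B P) := by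
  have h : Continuous fun π : ProbabilityMeasure (A × B) =>
      π.map (measurable_fst.aemeasurable (μ := (π : Measure (A × B)))) :=
    ProbabilityMeasure.continuous_map continuous_fst
  let P' : ProbabilityMeasure A := ⟨P, inferInstance⟩
  have hset : couplingsWithFst B P = (fun π : ProbabilityMeasure (A × B) =>
      π.map (measurable_fst.aemeasurable (μ := (π : Measure (A × B))))) ⁻¹' {P'} := by
    ext π
    exact (Subtype.ext_iff (a1 := π.map measurable_fst.aemeasurable) (a2 := P')).symm
  rw [hset]
  exact isClosed_singleton.preimage h

variable [CompactSpace B]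

theorem isCompact_couplingsWithFst (P : Measure A) [IsProbabilityMeasure P] :
    IsCompact (couplingsWithFst B P) := by
  rw [← (isClosed_couplingsWithFst (B := B) P).closure_eq]
  refine isCompact_closure_of_isTightMeasureSet
    (IsTightMeasureSet.prodMk ?_ IsTightMeasureSet.of_compactSpace)
  refine (isTightMeasureSet_singleton (μ := P)).subset ?_
  rintro _ ⟨_, ⟨π, hπ, rfl⟩, rfl⟩
  exact hπ

/-- Weak convergence of couplings with a fixed first marginal extends to integrands which are only
measurable in the first variable. -/
theorem continuousOn_integral_couplingsWithFst {P : Measure A} [IsProbabilityMeasure P]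
    {F : A → C(B, ℝ)} (hF : Integrable F P) :
    ContinuousOn (fun π : ProbabilityMeasure (A × B) => ∫ z, F z.1 z.2 ∂(π : Measure (A × B)))
      (couplingsWithFst B P) := by
  refine continuousOn_of_uniform_approx_of_continuousOn fun u hu => ?_
  obtain ⟨ε, hε, hu⟩ := Metric.mem_uniformity_dist.1 hu
  -- The error of replacing `F` by `G` is at most `∫ ‖F x - G x‖ ∂P`, which is the same for all
  -- couplings; the approximation is therefore uniform in `π`.
  obtain ⟨G, hG, hGi⟩ := hF.exists_boundedContinuous_integral_sub_le (half_pos hε)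
  have hGc : Continuous fun z : A × B => G z.1 z.2 :=
    (continuous_eval (F := C(B, ℝ))).comp
      ((G.continuous.comp continuous_fst).prodMk continuous_snd)
  set G' : A × B →ᵇ ℝ := BoundedContinuousFunction.ofNormedAddCommGroup _ hGc ‖G‖
    (fun z => ((G z.1).norm_coe_le_norm z.2).trans (G.norm_coe_le_norm z.1)) with hG'
  refine ⟨fun π => ∫ z, G' z ∂(π : Measure (A × B)), Continuous.continuousOn ?_, fun π hπ => ?_⟩
  · exact continuous_iff_continuousAt.2 fun p =>
      (ProbabilityMeasure.tendsto_iff_forall_integral_tendsto.1 tendsto_id) G'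
  · refine hu ?_
    have hsub : Integrable (fun x => ‖F x - G x‖) P := (hF.sub hGi).norm
    rw [Real.dist_eq, ← integral_sub (integrable_uncurry_of_fst hF hπ) (G'.integrable _)]
    calc |∫ z, (F z.1 z.2 - G' z) ∂(π : Measure (A × B))|
        ≤ ∫ z, ‖F z.1 - G z.1‖ ∂(π : Measure (A × B)) := by
          rw [← Real.norm_eq_abs]
          refine norm_integral_le_of_norm_le ?_ (ae_of_all _ fun z => ?_)
          · refine Integrable.comp_measurable (f := Prod.fst) (g := fun x => ‖F x - G x‖) ?_
              measurable_fst
            rw [← Measure.fst, hπ]; exact hsub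
          · exact (F z.1 - G z.1).norm_coe_le_norm z.2
      _ = ∫ x, ‖F x - G x‖ ∂P := by
          rw [← hπ, Measure.fst, integral_map measurable_fst.aemeasurable]
          rw [← Measure.fst, hπ]; exact hsub.1
      _ ≤ ε / 2 := hG
      _ < ε := half_lt_self hε

/-- By monotone convergence the bound on `d` amounts to the bound on every truncation `min d m`, and
each of these has a continuous integral on the couplings. -/
theorem isClosed_lintegral_le_couplingsWithFst (P : Measure A) [IsProbabilityMeasure P]
    {d : A → B → ℝ≥0∞} (hd : Measurable (Function.uncurry d)) (hdc : ∀ x, Continuous (d x))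
    (D : ℝ≥0∞) :
    IsClosed (couplingsWithFst B P ∩
      {π | ∫⁻ z, d z.1 z.2 ∂(π : Measure (A × B)) ≤ D}) := by
  have hne : ∀ (m : ℕ) (t : ℝ≥0∞), min t m ≠ ∞ := fun m t =>
    ((min_le_right _ _).trans_lt (ENNReal.natCast_lt_top m)).ne
  let F : ℕ → A → C(B, ℝ) := fun m x => ⟨fun y => (min (d x y) m).toReal,
    continuous_iff_continuousAt.2 fun y => (ENNReal.tendsto_toReal (hne m _)).comp
      ((hdc x).min continuous_const).continuousAt⟩
  have hF : ∀ m, Integrable (F m) P := fun m => by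
    refine Integrable.of_bound (C := m) (stronglyMeasurable_continuousMap fun y => ?_
      ).aestronglyMeasurable (ae_of_all _ fun x => ?_)
    · exact ((hd.comp (measurable_id.prodMk measurable_const)).min measurable_const).ennreal_toReal
    · refine (ContinuousMap.norm_le _ m.cast_nonneg).2 fun y => ?_
      simp only [F, ContinuousMap.coe_mk, Real.norm_eq_abs, ENNReal.abs_toReal]
      exact ENNReal.toReal_le_of_le_ofReal m.cast_nonneg (by simp)
  have hint : ∀ (m : ℕ), ∀ π ∈ couplingsWithFst B P,
      ∫⁻ z, min (d z.1 z.2) m ∂(π : Measure (A × B))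
        = ENNReal.ofReal (∫ z, F m z.1 z.2 ∂(π : Measure (A × B))) := fun m π hπ => by
    rw [ofReal_integral_eq_lintegral_ofReal (integrable_uncurry_of_fst (hF m) hπ)
      (ae_of_all _ fun z => ENNReal.toReal_nonneg)]
    exact lintegral_congr fun z => (ENNReal.ofReal_toReal (hne m _)).symm
  have hset : couplingsWithFst B P ∩ {π | ∫⁻ z, d z.1 z.2 ∂(π : Measure (A × B)) ≤ D}
      = ⋂ m : ℕ, couplingsWithFst B P ∩
        (fun π : ProbabilityMeasure (A × B) => ENNReal.ofReal
          (∫ z, F m z.1 z.2 ∂(π : Measure (A × B)))) ⁻¹' Set.Iic D := by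
    rw [← Set.inter_iInter]
    ext π
    refine and_congr_right fun hπ => ?_
    simp only [Set.mem_ofPred_eq, Set.mem_iInter, Set.mem_preimage, Set.mem_Iic]
    have hsup : ∫⁻ z, d z.1 z.2 ∂(π : Measure (A × B))
        = ⨆ m : ℕ, ∫⁻ z, min (d z.1 z.2) m ∂(π : Measure (A × B)) := by
      rw [← lintegral_iSup (f := fun (m : ℕ) (z : A × B) => min (d z.1 z.2) m)
        (fun m => hd.min measurable_const)]
      · refine lintegral_congr fun z => ?_
        rw [← inf_iSup_eq, ENNReal.iSup_natCast, inf_top_eq]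
      · intro m m' h z
        exact min_le_min_left _ (by exact_mod_cast h)
    rw [hsup, iSup_le_iff]
    exact forall_congr' fun m => by rw [hint m π hπ]
  rw [hset]
  exact isClosed_iInter fun m =>
    (ENNReal.continuous_ofReal.comp_continuousOn
      (continuousOn_integral_couplingsWithFst (hF m))).preimage_isClosed_of_isClosed
      (isClosed_couplingsWithFst P) isClosed_Iic

end Couplings

/-! ### Factorization through a map as conditional independence -/

section KernelThroughMap

open Filter Topology BoundedContinuousFunction

variable {A B C T : Type*} [MeasurableSpace A] [MeasurableSpace B] [MeasurableSpace C]
  [MeasurableSpace T]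

/-- A measure on `A × T` with first marginal `P` whose disintegration depends on the first
coordinate only through `r`. -/
def FactorsThrough (P : Measure A) (r : A → C) (hr : Measurable r) (π : Measure (A × T)) : Prop :=
  ∃ K : Kernel C T, IsMarkovKernel K ∧ π = P ⊗ₘ K.comap r hr

theorem compProd_comap_map {P : Measure A} [IsFiniteMeasure P] {r : A → C} (hr : Measurable r)
    (K : Kernel C T) [IsMarkovKernel K] :
    (P ⊗ₘ K.comap r hr).map (Prod.map r id) = P.map r ⊗ₘ K := by
  refine Measure.ext_of_lintegral _ fun f hf => ?_
  rw [lintegral_map hf (hr.prodMap measurable_id),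
    Measure.lintegral_compProd (f := fun z => f (Prod.map r id z))
      (hf.comp (hr.prodMap measurable_id)),
    Measure.lintegral_compProd hf, lintegral_map hf.lintegral_kernel_prod_right' hr]
  rfl

/-- Kernels with the same composition product agree almost everywhere, so a law factoring through
`r` is determined by its image on `C × T`. -/
theorem compProd_comap_congr {P : Measure A} [IsFiniteMeasure P] {r : A → C} (hr : Measurable r)
    [MeasurableSpace.CountablyGenerated T]
    {K L : Kernel C T} [IsMarkovKernel K] [IsMarkovKernel L]
    (h : P.map r ⊗ₘ K = P.map r ⊗ₘ L) : P ⊗ₘ K.comap r hr = P ⊗ₘ L.comap r hr := by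
  refine Measure.compProd_congr ?_
  have h' : K =ᵐ[P.map r] L := Kernel.ae_eq_of_compProd_eq h
  exact ae_of_ae_map hr.aemeasurable h'

variable [TopologicalSpace T]

theorem integral_compProd_comap_mul {P : Measure A} [IsFiniteMeasure P] {r : A → C}
    (hr : Measurable r) (K : Kernel C T) [IsMarkovKernel K] {f : A → ℝ} (hf : Measurable f) {M : ℝ}
    (hM : ∀ x, ‖f x‖ ≤ M) [BorelSpace T] (g : T →ᵇ ℝ) :
    ∫ z, f z.1 * g z.2 ∂(P ⊗ₘ K.comap r hr) = ∫ x, f x * ∫ y, g y ∂K (r x) ∂P := by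
  have hi : Integrable (fun z : A × T => f z.1 * g z.2) (P ⊗ₘ K.comap r hr) := by
    refine Integrable.of_bound (C := M * ‖g‖) ((hf.comp measurable_fst).mul
      (g.continuous.measurable.comp measurable_snd)).aestronglyMeasurable (ae_of_all _ fun p => ?_)
    rw [norm_mul]
    exact mul_le_mul (hM _) (g.norm_coe_le_norm _) (norm_nonneg _) ((norm_nonneg _).trans (hM p.1))
  rw [Measure.integral_compProd hi]
  simp_rw [integral_const_mul]
  rfl

theorem measurable_integral_kernel (K : Kernel C T) [IsMarkovKernel K] [BorelSpace T] (g : T →ᵇ ℝ) :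
    Measurable fun c => ∫ y, g y ∂K c :=
  (StronglyMeasurable.integral_kernel (κ := K) g.continuous.measurable.stronglyMeasurable).measurable

theorem norm_integral_kernel_le (K : Kernel C T) [IsMarkovKernel K] (g : T →ᵇ ℝ) (c : C) :
    ‖∫ y, g y ∂K c‖ ≤ ‖g‖ := by
  refine (norm_integral_le_of_norm_le_const (ae_of_all _ g.norm_coe_le_norm)).trans ?_
  simp

variable [StandardBorelSpace A] [Nonempty A]

/-- The conditional expectation of `f` given `r = c`. -/
noncomputable def condMean (P : Measure A) [IsFiniteMeasure P] (r : A → C) (f : A → ℝ) (c : C) :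
    ℝ :=
  ∫ x, f x ∂(condDistrib id r P c)

theorem stronglyMeasurable_condMean (P : Measure A) [IsFiniteMeasure P] (r : A → C) {f : A → ℝ}
    (hf : Measurable f) : StronglyMeasurable (condMean P r f) :=
  StronglyMeasurable.integral_condDistrib (f := fun p : C × A => f p.2)
    (hf.comp measurable_snd).stronglyMeasurable

theorem norm_condMean_le (P : Measure A) [IsFiniteMeasure P] (r : A → C) {f : A → ℝ} {M : ℝ}
    (hM : ∀ x, ‖f x‖ ≤ M) (c : C) : ‖condMean P r f c‖ ≤ M := by
  refine (norm_integral_le_of_norm_le_const (ae_of_all _ hM)).trans ?_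
  simp

/-- The defining property of conditional expectation, for the version `condMean` that is an honest
function on `C`. -/
theorem integral_condMean_mul (P : Measure A) [IsFiniteMeasure P] {r : A → C} (hr : Measurable r)
    {f : A → ℝ} (hf : Measurable f) {M : ℝ} (hM : ∀ x, ‖f x‖ ≤ M)
    {h : C → ℝ} (hh : Measurable h) {N : ℝ} (hN : ∀ c, ‖h c‖ ≤ N) :
    ∫ x, condMean P r f (r x) * h (r x) ∂P = ∫ x, f x * h (r x) ∂P := by
  have hm : Measurable fun p : C × A => f p.2 * h p.1 :=
    (hf.comp measurable_snd).mul (hh.comp measurable_fst)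
  have hmap : P.map r ⊗ₘ condDistrib id r P = P.map fun x => (r x, x) :=
    compProd_map_condDistrib (Y := id) aemeasurable_id
  have hi : Integrable (fun p : C × A => f p.2 * h p.1) (P.map r ⊗ₘ condDistrib id r P) := by
    refine Integrable.of_bound (C := M * N) hm.aestronglyMeasurable (ae_of_all _ fun p => ?_)
    rw [norm_mul]
    exact mul_le_mul (hM _) (hN _) (norm_nonneg _) ((norm_nonneg _).trans (hM p.2))
  have h1 := Measure.integral_compProd hi
  rw [hmap, integral_map (φ := fun x => (r x, x)) (hr.prodMk measurable_id).aemeasurable hm.aestronglyMeasurable] at h1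
  rw [h1]
  simp_rw [integral_mul_const]
  rw [integral_map hr.aemeasurable]
  · rfl
  · exact (((stronglyMeasurable_condMean P r hf).measurable).mul hh).aestronglyMeasurable

variable [TopologicalSpace A] [BorelSpace A] [HasOuterApproxClosed A] [BorelSpace T]
  [HasOuterApproxClosed T]

/-- The right side says that the two coordinates are conditionally independent given `r`. Since
`condMean` depends only on `P`, each equation is linear in `π`. Conversely, the conditional law of
the second coordinate given `r` serves as the kernel, because products of bounded continuous
functions determine a finite measure. -/
theorem factorsThrough_iff [StandardBorelSpace T] [Nonempty T] {P : Measure A}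
    [IsProbabilityMeasure P] {r : A → C} (hr : Measurable r) {π : Measure (A × T)}
    [IsFiniteMeasure π] (hπ : π.fst = P) :
    FactorsThrough P r hr π ↔ ∀ (f : A →ᵇ ℝ) (g : T →ᵇ ℝ),
      ∫ z, f z.1 * g z.2 ∂π = ∫ z, condMean P r f (r z.1) * g z.2 ∂π := by
  constructor
  · rintro ⟨K, hK, rfl⟩ f g
    rw [integral_compProd_comap_mul hr K f.continuous.measurable f.norm_coe_le_norm,
      integral_compProd_comap_mul hr K (f := fun x => condMean P r f (r x))
        ((stronglyMeasurable_condMean P r f.continuous.measurable).measurable.comp hr)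
        (fun x => norm_condMean_le P r f.norm_coe_le_norm _)]
    exact (integral_condMean_mul P hr f.continuous.measurable f.norm_coe_le_norm
      (measurable_integral_kernel K g) (norm_integral_kernel_le K g)).symm
  · intro h
    set K := condDistrib (fun z : A × T => z.2) (fun z => r z.1) π with hK
    refine ⟨K, inferInstance, Measure.ext_of_integral_mul_boundedContinuousFunction fun f g => ?_⟩
    have hfm := f.continuous.measurable
    have hcm := (stronglyMeasurable_condMean P r hfm).measurable
    have hgm := g.continuous.measurable
    have hr1 : Measurable fun z : A × T => r z.1 := hr.comp measurable_fst
    have hPr : π.map (fun z => r z.1) = P.map r := by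
      rw [← hπ, Measure.fst, Measure.map_map hr measurable_fst]; rfl
    have hmap : P.map r ⊗ₘ K = π.map fun z => (r z.1, z.2) := by
      rw [← hPr]; exact compProd_map_condDistrib measurable_snd.aemeasurable
    have hm : Measurable fun p : C × T => condMean P r f p.1 * g p.2 :=
      (hcm.comp measurable_fst).mul (hgm.comp measurable_snd)
    have hi : Integrable (fun p : C × T => condMean P r f p.1 * g p.2) (P.map r ⊗ₘ K) := by
      refine Integrable.of_bound (C := ‖f‖ * ‖g‖) hm.aestronglyMeasurable (ae_of_all _ fun p => ?_)
      rw [norm_mul]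
      exact mul_le_mul (norm_condMean_le P r f.norm_coe_le_norm _) (g.norm_coe_le_norm _)
        (norm_nonneg _) (norm_nonneg _)
    have h1 := Measure.integral_compProd hi
    rw [hmap, integral_map (hr1.prodMk measurable_snd).aemeasurable hm.aestronglyMeasurable] at h1
    rw [h f g, integral_compProd_comap_mul hr K hfm f.norm_coe_le_norm]
    refine h1.trans ?_
    simp_rw [integral_const_mul]
    rw [integral_map hr.aemeasurable]
    · exact integral_condMean_mul P hr hfm f.norm_coe_le_norm
        (measurable_integral_kernel K g) (norm_integral_kernel_le K g)
    · exact (hcm.mul (measurable_integral_kernel K g)).aestronglyMeasurable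

end KernelThroughMap

/-! ### Weak closedness of the factorization constraint -/

section ClosedFactorsThrough

open Filter Topology BoundedContinuousFunction

variable {A B C T : Type*} [TopologicalSpace A] [PolishSpace A] [MeasurableSpace A] [BorelSpace A]
  [TopologicalSpace B] [PolishSpace B] [MeasurableSpace B] [BorelSpace B] [CompactSpace B]
  [TopologicalSpace T]

theorem continuousOn_integral_mul_couplingsWithFst {P : Measure A} [IsProbabilityMeasure P]
    {f : A → ℝ} (hf : Measurable f) {M : ℝ} (hM : ∀ x, ‖f x‖ ≤ M) {t : B → T} (ht : Continuous t)
    (g : T →ᵇ ℝ) :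
    ContinuousOn (fun π : ProbabilityMeasure (A × B) =>
      ∫ z, f z.1 * g (t z.2) ∂(π : Measure (A × B))) (couplingsWithFst B P) := by
  have hi : Integrable (fun x => f x • (⟨fun y => g (t y), by fun_prop⟩ : C(B, ℝ))) P :=
    (Integrable.of_bound hf.aestronglyMeasurable M (ae_of_all _ hM)).smul_const _
  exact continuousOn_integral_couplingsWithFst hi

variable [MeasurableSpace C] [PolishSpace T] [MeasurableSpace T] [BorelSpace T]

/-- Each equation of `factorsThrough_iff` equates two functionals that are continuous on the
couplings, even though `condMean` is only measurable. -/
theorem isClosed_factorsThrough_couplingsWithFst [Nonempty A] [Nonempty T] (P : Measure A)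
    [IsProbabilityMeasure P] {r : A → C} (hr : Measurable r) {t : B → T} (ht : Continuous t) :
    IsClosed (couplingsWithFst B P ∩
      {π | FactorsThrough P r hr ((π : Measure (A × B)).map (Prod.map id t))}) := by
  have htm : Measurable (Prod.map id t : A × B → A × T) := measurable_id.prodMap ht.measurable
  have hset : couplingsWithFst B P ∩
      {π | FactorsThrough P r hr ((π : Measure (A × B)).map (Prod.map id t))}
      = ⋂ p : (A →ᵇ ℝ) × (T →ᵇ ℝ), couplingsWithFst B P ∩
        (fun π : ProbabilityMeasure (A × B) => ∫ z, p.1 z.1 * p.2 (t z.2) ∂(π : Measure (A × B))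
          - ∫ z, condMean P r p.1 (r z.1) * p.2 (t z.2) ∂(π : Measure (A × B))) ⁻¹' {0} := by
    rw [← Set.inter_iInter]
    ext π
    refine and_congr_right fun hπ => ?_
    have hπ' : ((π : Measure (A × B)).map (Prod.map id t)).fst = P := by
      rw [← show _ = P from hπ, Measure.fst, Measure.map_map measurable_fst htm]; rfl
    have := Measure.isProbabilityMeasure_map (μ := (π : Measure (A × B))) htm.aemeasurable
    rw [Set.mem_ofPred_eq, factorsThrough_iff hr hπ']
    simp only [Set.mem_iInter, Set.mem_preimage, Set.mem_singleton_iff, Prod.forall, sub_eq_zero]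
    refine forall_congr' fun f => forall_congr' fun g => ?_
    have hgm := g.continuous.measurable
    rw [integral_map htm.aemeasurable, integral_map htm.aemeasurable]
    · rfl
    · exact ((((stronglyMeasurable_condMean P r f.continuous.measurable).measurable.comp
        hr).comp measurable_fst).mul (hgm.comp measurable_snd)).aestronglyMeasurable
    · exact ((f.continuous.measurable.comp measurable_fst).mul
        (hgm.comp measurable_snd)).aestronglyMeasurable
  rw [hset]
  refine isClosed_iInter fun p => ContinuousOn.preimage_isClosed_of_isClosed
    (ContinuousOn.sub ?_ ?_) (isClosed_couplingsWithFst P) isClosed_singleton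
  · exact continuousOn_integral_mul_couplingsWithFst p.1.continuous.measurable
      p.1.norm_coe_le_norm ht p.2
  · exact continuousOn_integral_mul_couplingsWithFst (f := fun x => condMean P r p.1 (r x))
      ((stronglyMeasurable_condMean P r p.1.continuous.measurable).measurable.comp hr)
      (fun x => norm_condMean_le P r p.1.norm_coe_le_norm _) ht p.2

end ClosedFactorsThrough

/-! ### Causal kernels and causal joint laws -/

section Causality

variable {X : ℕ → Type u} {Y : ℕ → Type v}

/-- The first `k` letters of a string of length `m`. -/
def Hist.take {Z : ℕ → Type u} {k m : ℕ} (h : k ≤ m) (z : Hist Z m) : Hist Z k :=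
  fun j => z (Fin.castLE h j)

theorem Hist.measurable_take {Z : ℕ → Type u} [∀ i, MeasurableSpace (Z i)] {k m : ℕ} (h : k ≤ m) :
    Measurable (Hist.take h : Hist Z m → Hist Z k) :=
  measurable_pi_lambda _ fun j => measurable_pi_apply (Fin.castLE h j)

theorem Hist.continuous_take {Z : ℕ → Type u} [∀ i, TopologicalSpace (Z i)] {k m : ℕ}
    (h : k ≤ m) : Continuous (Hist.take h : Hist Z m → Hist Z k) :=
  continuous_pi fun j => continuous_apply (Fin.castLE h j)

theorem Hist.init_snoc {Z : ℕ → Type u} {k : ℕ} (p : Hist Z k × Z k) :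
    Hist.init (Hist.snoc p) = p.1 := by
  funext j
  simp [Hist.init, Hist.snoc]

theorem Hist.snoc_take {Z : ℕ → Type u} {k m : ℕ} (h : k + 1 ≤ m) (z : Hist Z m) :
    Hist.snoc (Hist.take (Nat.le_of_succ_le h) z, z ⟨k, h⟩) = Hist.take h z := by
  funext j
  refine Fin.lastCases ?_ (fun j => ?_) j
  · simp only [Hist.snoc, Fin.snoc_last]; rfl
  · simp only [Hist.snoc, Fin.snoc_castSucc]; rfl

variable [∀ i, MeasurableSpace (X i)] [∀ i, MeasurableSpace (Y i)]

theorem map_init_causalProd (κ : ReproductionKernels X Y) {k : ℕ}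
    (hκ : ∀ i < k + 1, IsMarkovKernel (κ i)) :
    (causalProd κ (k + 1)).map Hist.init
      = (causalProd κ k).comap Hist.init Hist.measurable_init := by
  have := isMarkovKernel_causalProd κ k fun i hi => hκ i (by omega)
  have := hκ k (by omega)
  rw [causalProd, ← Kernel.map_comp_right _ Hist.measurable_snoc Hist.measurable_init]
  have h : (Hist.init ∘ Hist.snoc : Hist Y k × Y k → Hist Y k) = Prod.fst :=
    funext Hist.init_snoc
  rw [h, ← Kernel.fst_eq, Kernel.fst_compProd]

/-- The later kernels have total mass one and integrate out, so the first `k` output letters do not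
see later inputs. -/
theorem map_take_causalProd (κ : ReproductionKernels X Y) {k m : ℕ} (h : k ≤ m)
    (hκ : ∀ i < m, IsMarkovKernel (κ i)) :
    (causalProd κ m).map (Hist.take h)
      = (causalProd κ k).comap (Hist.take h) (Hist.measurable_take h) := by
  induction m, h using Nat.le_induction with
  | base =>
    change (causalProd κ k).map id = (causalProd κ k).comap id measurable_id
    rw [Kernel.map_id, Kernel.comap_id]
  | succ m hkm ih =>
    have ih := ih fun i hi => hκ i (by omega)
    have hY : (Hist.take (hkm.trans m.le_succ) : Hist Y (m + 1) → Hist Y k)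
        = Hist.take hkm ∘ Hist.init := rfl
    rw [hY, Kernel.map_comp_right _ Hist.measurable_init (Hist.measurable_take hkm),
      map_init_causalProd κ hκ]
    rw [← Kernel.comap_map_comm _ Hist.measurable_init (Hist.measurable_take hkm), ih,
      ← Kernel.comap_comp_right]
    rfl

/-- Appending one letter: a measure on pairs of strings of length `k` and one reproduction kernel
compose to the law given by the convolution kernel of length `k + 1`. -/
theorem map_snoc_compProd_causalProd (κ : ReproductionKernels X Y) {k : ℕ}
    (hκ : ∀ i < k + 1, IsMarkovKernel (κ i)) (P : Measure (Hist X (k + 1))) [IsFiniteMeasure P] :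
    (((P ⊗ₘ (causalProd κ k).comap Hist.init Hist.measurable_init).map Prod.swap) ⊗ₘ κ k).map
      (fun p => (p.1.2, Hist.snoc (p.1.1, p.2))) = P ⊗ₘ causalProd κ (k + 1) := by
  have := isMarkovKernel_causalProd κ k fun i hi => hκ i (by omega)
  have := isMarkovKernel_causalProd κ (k + 1) hκ
  have := hκ k (by omega)
  have hG : Measurable fun p : (Hist Y k × Hist X (k + 1)) × Y k =>
      (p.1.2, Hist.snoc (p.1.1, p.2)) :=
    (measurable_snd.comp measurable_fst).prodMk (Hist.measurable_snoc.comp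
      ((measurable_fst.comp measurable_fst).prodMk measurable_snd))
  refine Measure.ext_of_lintegral _ fun f hf => ?_
  have hfG : Measurable fun p : (Hist Y k × Hist X (k + 1)) × Y k =>
      f (p.1.2, Hist.snoc (p.1.1, p.2)) := hf.comp hG
  rw [lintegral_map hf hG, Measure.lintegral_compProd hfG,
    lintegral_map hfG.lintegral_kernel_prod_right' measurable_swap,
    Measure.lintegral_compProd hf]
  refine (Measure.lintegral_compProd (f := fun a : Hist X (k + 1) × Hist Y k =>
    ∫⁻ b, f (a.1, Hist.snoc (a.2, b)) ∂κ k a.swap)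
    ((hfG.lintegral_kernel_prod_right' (κ := κ k)).comp measurable_swap)).trans ?_
  refine lintegral_congr fun x => ?_
  have hfx : Measurable fun y => f (x, y) := hf.comp measurable_prodMk_left
  rw [causalProd, Kernel.map_apply _ Hist.measurable_snoc, lintegral_map hfx Hist.measurable_snoc]
  exact (Kernel.lintegral_compProd ((causalProd κ k).comap Hist.init Hist.measurable_init)
    ((κ k).comap Prod.swap measurable_swap) x (hfx.comp Hist.measurable_snoc)).symm

theorem nonempty_of_isMarkovKernel_causal {m : ℕ} (κ : ReproductionKernels X Y)
    (hκ : ∀ i < m, IsMarkovKernel (κ i)) [Nonempty (Hist X m)] (i : ℕ) (hi : i < m) :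
    Nonempty (Y i) := by
  have := isMarkovKernel_causalProd κ m hκ
  obtain ⟨x⟩ := ‹Nonempty (Hist X m)›
  obtain ⟨y⟩ := nonempty_of_isProbabilityMeasure (causalProd κ m x)
  exact ⟨y ⟨i, hi⟩⟩

/-- A joint law of strings of length `m` is causal if, for each `k ≤ m`, the conditional law of the
first `k` letters of the second string given the first string depends only on the first `k` letters
of the latter. -/
def IsCausal {m : ℕ} (P : Measure (Hist X m)) (π : Measure (Hist X m × Hist Y m)) : Prop :=
  ∀ (k : ℕ) (h : k ≤ m), FactorsThrough P (Hist.take h) (Hist.measurable_take h)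
    (π.map (Prod.map id (Hist.take h)))

theorem isCausal_compProd_causalProd (κ : ReproductionKernels X Y) {m : ℕ}
    (hκ : ∀ i < m, IsMarkovKernel (κ i)) (P : Measure (Hist X m)) [IsFiniteMeasure P] :
    IsCausal P (P ⊗ₘ causalProd κ m) := by
  intro k h
  have := isMarkovKernel_causalProd κ m hκ
  refine ⟨causalProd κ k, isMarkovKernel_causalProd κ k fun i hi => hκ i (by omega), ?_⟩
  rw [← map_take_causalProd κ h hκ, Measure.compProd_map (Hist.measurable_take h)]

open Classical in
/-- The conditional laws of each letter of the second string given the past. -/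
noncomputable def condKernels {m : ℕ} [∀ i, StandardBorelSpace (Y i)]
    (hY : ∀ i < m, Nonempty (Y i)) (π : Measure (Hist X m × Hist Y m)) [IsFiniteMeasure π] :
    ReproductionKernels X Y := fun i =>
  if h : i < m then
    have := hY i h
    condDistrib (fun z => z.2 ⟨i, h⟩) (fun z => (Hist.take h.le z.2, Hist.take h z.1)) π
  -- Junk value: `causalProd` of length `m` uses only the indices below `m`.
  else 0

theorem isMarkovKernel_condKernels {m : ℕ} [∀ i, StandardBorelSpace (Y i)]
    (hY : ∀ i < m, Nonempty (Y i)) (π : Measure (Hist X m × Hist Y m)) [IsFiniteMeasure π]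
    (i : ℕ) (h : i < m) : IsMarkovKernel (condKernels hY π i) := by
  unfold condKernels
  rw [dif_pos h]
  have := hY i h
  infer_instance

theorem compProd_condKernels {m : ℕ} [∀ i, StandardBorelSpace (Y i)]
    (hY : ∀ i < m, Nonempty (Y i)) (π : Measure (Hist X m × Hist Y m)) [IsFiniteMeasure π]
    (i : ℕ) (h : i < m) :
    π.map (fun z => (Hist.take h.le z.2, Hist.take h z.1)) ⊗ₘ condKernels hY π i
      = π.map fun z => ((Hist.take h.le z.2, Hist.take h z.1), z.2 ⟨i, h⟩) := by
  unfold condKernels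
  rw [dif_pos h]
  have := hY i h
  exact compProd_map_condDistrib ((measurable_pi_apply _).comp measurable_snd).aemeasurable

/-- Induction on `k`. The chain rule identifies only the joint law of `x^{k+1}` and `y^{k+1}`;
causality upgrades this to the joint law of the whole input string and `y^{k+1}`. -/
theorem map_take_eq_compProd_causalProd {m : ℕ} [∀ i, StandardBorelSpace (Y i)]
    (hY : ∀ i < m, Nonempty (Y i)) {P : Measure (Hist X m)} [IsFiniteMeasure P]
    {π : Measure (Hist X m × Hist Y m)} [IsFiniteMeasure π] (hc : IsCausal P π) (k : ℕ)
    (h : k ≤ m) :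
    π.map (Prod.map id (Hist.take h))
      = P ⊗ₘ (causalProd (condKernels hY π) k).comap (Hist.take h) (Hist.measurable_take h) := by
  induction k with
  | zero =>
    obtain ⟨K, hK, hKπ⟩ := hc 0 h
    rw [hKπ]
    -- Strings of length zero form a one-point space, on which any two Markov kernels coincide.
    congr 2
    have : IsMarkovKernel (causalProd (condKernels hY π) 0) :=
      isMarkovKernel_causalProd _ 0 fun i hi => absurd hi (Nat.not_lt_zero i)
    ext x s -
    rcases s.eq_empty_or_nonempty with rfl | ⟨y, hy⟩
    · simp
    · have hs : s = Set.univ := Set.eq_univ_of_forall fun z => Subsingleton.elim y z ▸ hy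
      rw [hs, measure_univ, measure_univ]
  | succ k ih =>
    have ih := ih (Nat.le_of_succ_le h)
    set κ := condKernels hY π with hκdef
    have hκ : ∀ i < k + 1, IsMarkovKernel (κ i) := fun i hi =>
      isMarkovKernel_condKernels hY π i (by omega)
    have := isMarkovKernel_causalProd κ k fun i hi => hκ i (by omega)
    have := isMarkovKernel_causalProd κ (k + 1) hκ
    obtain ⟨K, hK, hKπ⟩ := hc (k + 1) h
    have htX := Hist.measurable_take (Z := X) h
    have htY := Hist.measurable_take (Z := Y) h
    have htY' := Hist.measurable_take (Z := Y) (Nat.le_of_succ_le h)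
    have hlast : Measurable fun z : Hist X m × Hist Y m => z.2 ⟨k, h⟩ :=
      (measurable_pi_apply _).comp measurable_snd
    have hG : Measurable fun p : (Hist Y k × Hist X (k + 1)) × Y k =>
        (p.1.2, Hist.snoc (p.1.1, p.2)) :=
      (measurable_snd.comp measurable_fst).prodMk (Hist.measurable_snoc.comp
        ((measurable_fst.comp measurable_fst).prodMk measurable_snd))
    have h1 : π.map (Prod.map (Hist.take h) (Hist.take (Nat.le_of_succ_le h)))
        = P.map (Hist.take h) ⊗ₘ (causalProd κ k).comap Hist.init Hist.measurable_init := by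
      rw [← compProd_comap_map htX, ← Kernel.comap_comp_right]
      refine Eq.trans ?_ (congrArg (Measure.map (Prod.map (Hist.take h) id)) ih)
      rw [Measure.map_map (htX.prodMap measurable_id) (measurable_id.prodMap htY')]
      rfl
    have h2 : π.map (Prod.map (Hist.take h) (Hist.take h))
        = P.map (Hist.take h) ⊗ₘ causalProd κ (k + 1) := by
      rw [← map_snoc_compProd_causalProd κ hκ, ← h1,
        Measure.map_map measurable_swap (htX.prodMap htY')]
      have h3 := compProd_condKernels hY π k h
      refine Eq.trans ?_ (congrArg (Measure.map fun p => (p.1.2, Hist.snoc (p.1.1, p.2))) h3).symm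
      have hF : Measurable fun z : Hist X m × Hist Y m =>
          ((Hist.take (Nat.le_of_succ_le h) z.2, Hist.take h z.1), z.2 ⟨k, h⟩) :=
        ((htY'.comp measurable_snd).prodMk (htX.comp measurable_fst)).prodMk hlast
      rw [Measure.map_map hG hF]
      congr 1
      funext z
      exact Prod.ext rfl (Hist.snoc_take h z.2).symm
    -- Both sides now factor through the first `k + 1` inputs, so comparing their images there,
    -- which is `h2`, suffices.
    rw [hKπ]
    refine compProd_comap_congr htX ?_
    rw [← h2, ← compProd_comap_map htX, ← hKπ,
      Measure.map_map (htX.prodMap measurable_id) (measurable_id.prodMap htY)]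
    rfl

theorem eq_compProd_causalProd_of_isCausal {m : ℕ} [∀ i, StandardBorelSpace (Y i)]
    (hY : ∀ i < m, Nonempty (Y i)) {P : Measure (Hist X m)} [IsFiniteMeasure P]
    {π : Measure (Hist X m × Hist Y m)} [IsFiniteMeasure π] (hc : IsCausal P π) :
    π = P ⊗ₘ causalProd (condKernels hY π) m :=
  Measure.map_id.symm.trans (map_take_eq_compProd_causalProd hY hc m le_rfl)

end Causality

/-! ### Compactness of the feasible set and existence of a minimizer -/

section Existence

variable {X : ℕ → Type u} {Y : ℕ → Type v}
  [∀ i, TopologicalSpace (X i)] [∀ i, PolishSpace (X i)]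
  [∀ i, MeasurableSpace (X i)] [∀ i, BorelSpace (X i)]
  [∀ i, TopologicalSpace (Y i)] [∀ i, PolishSpace (Y i)]
  [∀ i, MeasurableSpace (Y i)] [∀ i, BorelSpace (Y i)] {m : ℕ}

theorem isCompact_causal_couplings [CompactSpace (Hist Y m)] (hY : ∀ i < m, Nonempty (Y i))
    (P : Measure (Hist X m)) [IsProbabilityMeasure P] {d : Hist X m → Hist Y m → ℝ≥0∞}
    (hd_meas : Measurable (Function.uncurry d)) (hd_cont : ∀ x, Continuous (d x)) (D : ℝ≥0∞) :
    IsCompact {π : ProbabilityMeasure (Hist X m × Hist Y m) | π ∈ couplingsWithFst (Hist Y m) P ∧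
      IsCausal P (π : Measure (Hist X m × Hist Y m)) ∧
      ∫⁻ z, d z.1 z.2 ∂(π : Measure (Hist X m × Hist Y m)) ≤ D} := by
  have : Nonempty (Hist X m) := nonempty_of_isProbabilityMeasure P
  refine (isCompact_couplingsWithFst (B := Hist Y m) P).of_isClosed_subset ?_ fun π hπ => hπ.1
  have h1 := isClosed_lintegral_le_couplingsWithFst P hd_meas hd_cont D
  have h2 : IsClosed (⋂ k : Fin (m + 1), couplingsWithFst (Hist Y m) P ∩
      {π | FactorsThrough P (Hist.take (Nat.le_of_lt_succ k.2))
        (Hist.measurable_take (Nat.le_of_lt_succ k.2))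
        ((π : Measure (Hist X m × Hist Y m)).map
          (Prod.map id (Hist.take (Nat.le_of_lt_succ k.2))))}) := by
    refine isClosed_iInter fun k => ?_
    have : Nonempty (Hist Y k) := ⟨fun j => (hY j (by omega)).some⟩
    exact isClosed_factorsThrough_couplingsWithFst P _ (Hist.continuous_take _)
  convert h1.inter h2 using 1
  ext π
  simp only [Set.mem_ofPred_eq, Set.mem_inter_iff, Set.mem_iInter]
  constructor
  · rintro ⟨hπ, hc, hD⟩
    exact ⟨⟨hπ, hD⟩, fun k => ⟨hπ, hc k (Nat.le_of_lt_succ k.2)⟩⟩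
  · rintro ⟨⟨hπ, hD⟩, hc⟩
    exact ⟨hπ, fun k hk => (hc ⟨k, Nat.lt_succ_of_le hk⟩).2, hD⟩

/-- Marginals and products of probability measures are weakly continuous, so joint lower
semicontinuity can be composed with them. -/
theorem lowerSemicontinuous_klDiv_prod_snd {A B : Type*} [TopologicalSpace A] [PolishSpace A]
    [MeasurableSpace A] [BorelSpace A] [TopologicalSpace B] [PolishSpace B] [MeasurableSpace B]
    [BorelSpace B] (P : Measure A) [IsProbabilityMeasure P] :
    LowerSemicontinuous fun π : ProbabilityMeasure (A × B) =>
      InformationTheory.klDiv (π : Measure (A × B)) (P.prod (π : Measure (A × B)).snd) := by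
  let P' : ProbabilityMeasure A := ⟨P, inferInstance⟩
  have hsnd : Continuous fun π : ProbabilityMeasure (A × B) =>
      π.map (measurable_snd.aemeasurable (μ := (π : Measure (A × B)))) :=
    ProbabilityMeasure.continuous_map continuous_snd
  have hprod : Continuous fun π : ProbabilityMeasure (A × B) =>
      (π, P'.prod (π.map (measurable_snd.aemeasurable (μ := (π : Measure (A × B)))))) :=
    continuous_id.prodMk (ProbabilityMeasure.continuous_prod.comp
      (continuous_const.prodMk hsnd))
  exact lowerSemicontinuous_klDiv.comp hprod

end Existence

theorem mainTheorem1 (X : ℕ → Type u) (Y : ℕ → Type v)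
    [∀ i, TopologicalSpace (X i)] [∀ i, PolishSpace (X i)]
    [∀ i, MeasurableSpace (X i)] [∀ i, BorelSpace (X i)]
    [∀ i, TopologicalSpace (Y i)] [∀ i, PolishSpace (Y i)]
    [∀ i, MeasurableSpace (Y i)] [∀ i, BorelSpace (Y i)]
    (n : ℕ) [CompactSpace (Hist Y (n + 1))]
    (P : Measure (Hist X (n + 1))) [IsProbabilityMeasure P]
    (d : Hist X (n + 1) → Hist Y (n + 1) → ℝ≥0∞)
    (hd_meas : Measurable (Function.uncurry d))
    (hd_cont : ∀ x, Continuous (d x))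
    (D : ℝ≥0) (hD : (fidelitySet P d D).Nonempty) :
    ∃ Q ∈ fidelitySet P d D, directedInfo P Q = nonanticipativeRDF P d D := by
  have : Nonempty (Hist X (n + 1)) := nonempty_of_isProbabilityMeasure P
  obtain ⟨Q₀, ⟨κ₀, hκ₀, rfl⟩, hD₀⟩ := hD
  -- A feasible kernel forces the letter spaces to be inhabited, as conditional distributions
  -- require.
  have hY : ∀ i < n + 1, Nonempty (Y i) := fun i hi =>
    nonempty_of_isMarkovKernel_causal κ₀ (fun j hj => hκ₀ j (Nat.le_of_lt_succ hj)) i hi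
  have hmem : ∀ (κ : ReproductionKernels X Y) (hκ : ∀ i ≤ n, IsMarkovKernel (κ i)),
      ∫⁻ z, d z.1 z.2 ∂(P ⊗ₘ causalProd κ (n + 1)) ≤ D →
      ∃ π : ProbabilityMeasure (Hist X (n + 1) × Hist Y (n + 1)),
        (π : Measure (Hist X (n + 1) × Hist Y (n + 1))) = P ⊗ₘ causalProd κ (n + 1) ∧
        π ∈ couplingsWithFst (Hist Y (n + 1)) P ∧
        IsCausal P (π : Measure (Hist X (n + 1) × Hist Y (n + 1))) ∧
        ∫⁻ z, d z.1 z.2 ∂(π : Measure (Hist X (n + 1) × Hist Y (n + 1))) ≤ D := by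
    intro κ hκ hle
    have hκ' : ∀ i < n + 1, IsMarkovKernel (κ i) := fun i hi => hκ i (Nat.le_of_lt_succ hi)
    have := isMarkovKernel_causalProd κ (n + 1) hκ'
    exact ⟨⟨P ⊗ₘ causalProd κ (n + 1), inferInstance⟩, rfl, Measure.fst_compProd _ _,
      isCausal_compProd_causalProd κ hκ' P, hle⟩
  obtain ⟨π₀, -, hπ₀⟩ := hmem κ₀ hκ₀ hD₀
  obtain ⟨π, ⟨hπfst, hπc, hπD⟩, hπmin⟩ := LowerSemicontinuousOn.exists_isMinOn ⟨π₀, hπ₀⟩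
    (isCompact_causal_couplings hY P hd_meas hd_cont D)
    ((lowerSemicontinuous_klDiv_prod_snd P).lowerSemicontinuousOn _)
  -- Distortion and directed information see a kernel only through its joint law, so any causal
  -- kernel with joint law `π` is optimal.
  have hπ := eq_compProd_causalProd_of_isCausal hY hπc
  set κ := condKernels hY (π : Measure (Hist X (n + 1) × Hist Y (n + 1))) with hκ
  have hQ : causalProd κ (n + 1) ∈ fidelitySet P d D :=
    ⟨⟨κ, fun i hi => isMarkovKernel_condKernels hY _ i (Nat.lt_succ_of_le hi), rfl⟩, by
      rw [← hπ]; exact hπD⟩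
  refine ⟨causalProd κ (n + 1), hQ, le_antisymm ?_ (iInf₂_le _ hQ)⟩
  refine le_iInf₂ fun Q hQ' => ?_
  obtain ⟨⟨κ', hκ', rfl⟩, hle⟩ := hQ'
  obtain ⟨π', hπ', hmem'⟩ := hmem κ' hκ' hle
  have := hπmin hmem'
  simp only [Set.mem_ofPred_eq] at this
  rw [directedInfo, directedInfo, ← hπ, ← hπ']
  exact this
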